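/- Let $d \ge 1$ be an integer and let $(\rho_n)_{n\in\mathbb{N}}$ be a sequence of radial mollifiers, i.e. $\rho_n \in L^1_{\mathrm{loc}}(0,+\infty)$, $\rho_n \ge 0$, $$\int_0^\infty \rho_n(r)\, r^{d-1}\,dr = 1 \quad \text{for all } n, \qquad \lim_{n\to\infty} \int_\delta^\infty \rho_n(r)\, r^{d-1}\,dr = 0 \quad \text{for all } \delta>0.$$ For $p \ge 1$ and $u \in L^1_{\mathrm{loc}}(\mathbb{R}^d)$ set $$D_{n,p}(u)(x) = \int_{\mathbb{R}^d} \frac{|u(x)-u(y)|^p}{|x-y|^p}\,\rho_n(|x-y|)\,dy \in [0,+\infty], \qquad \gamma_{d,p} = \int_{\mathbb{S}^{d-1}} |\sigma\cdot e|^p\,d\sigma,$$ where $e \in \mathbb{S}^{d-1}$ is any unit vector and $d\sigma$ is the surface measure on the unit sphere. Let $p \ge 1$ and let $u \in L^1_{\mathrm{loc}}(\mathbb{R}^d)$ be a real-valued function whose distributional gradient satisfies $\nabla u \in L^p(\mathbb{R}^d)$. Then $$\lim_{n\to\infty} \int_{\mathbb{R}^d}\int_{\mathbb{R}^d} \frac{|u(x+h)-u(x)-\nabla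 u(x)\cdot h|^p}{|h|^p}\,\rho_n(|h|)\,dh\,dx = 0.$$ Consequently, for every $n$, $D_{n,p}(u)$ is finite almost everywhere and belongs to $L^1(\mathbb{R}^d)$, the function $\gamma_{d,p}|\nabla u|^p$ belongs to $L^1(\mathbb{R}^d)$, and $$\lim_{n\to\infty} D_{n,p}(u) = \gamma_{d,p}\,|\nabla u|^p \quad \text{in } L^1(\mathbb{R}^d).$$ -/

import Mathlib

open MeasureTheory Filter Topology
open scoped ENNReal ContDiff

noncomputable section

/-- A sequence of radial mollifiers `ρ n` on `(0, ∞)` for dimension `d`: locally integrable on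
`(0, ∞)`, nonnegative, of unit mass for `r ^ (d - 1) dr`, with mass concentrating at `0`.
(The mass condition forces `r ↦ ρ n r * r ^ (d - 1)` to be integrable on `(0, ∞)`.) -/
structure IsRadialMollifier (d : ℕ) (ρ : ℕ → ℝ → ℝ) : Prop where
  locallyIntegrableOn : ∀ n, LocallyIntegrableOn (ρ n) (Set.Ioi 0) volume
  nonneg : ∀ n, ∀ᵐ r ∂(volume.restrict (Set.Ioi (0 : ℝ))), 0 ≤ ρ n r
  integral_eq_one : ∀ n, ∫ r in Set.Ioi (0 : ℝ), ρ n r * r ^ (d - 1) = 1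
  tendsto_tail : ∀ δ : ℝ, 0 < δ →
    Tendsto (fun n => ∫ r in Set.Ioi δ, ρ n r * r ^ (d - 1)) atTop (𝓝 0)

/-- `G` is the weak (distributional) gradient of `u` on `ℝ^d`: both are locally integrable and
`∫ u ∂ᵢφ = - ∫ φ Gᵢ` for every smooth compactly supported `φ` and every coordinate `i`. -/
structure HasWeakGradient {d : ℕ} (u : EuclideanSpace ℝ (Fin d) → ℝ)
    (G : EuclideanSpace ℝ (Fin d) → EuclideanSpace ℝ (Fin d)) : Prop where
  locallyIntegrable : LocallyIntegrable u volume
  locallyIntegrable_grad : LocallyIntegrable G volume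
  integral_eq : ∀ φ : EuclideanSpace ℝ (Fin d) → ℝ, ContDiff ℝ ∞ φ → HasCompactSupport φ →
    ∀ i : Fin d, ∫ x, u x * fderiv ℝ φ x (EuclideanSpace.single i 1) = - ∫ x, φ x * G x i

/-- `D_p(u)(x) = ∫ |u(x) - u(y)|^p / |x - y|^p ρ(|x - y|) dy`, with values in `[0, ∞]`. -/
def nonlocalD {d : ℕ} (ρ : ℝ → ℝ) (p : ℝ) (u : EuclideanSpace ℝ (Fin d) → ℝ)
    (x : EuclideanSpace ℝ (Fin d)) : ℝ≥0∞ :=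
  ∫⁻ y, ENNReal.ofReal (|u x - u y| ^ p / ‖x - y‖ ^ p * ρ ‖x - y‖)

/-- `γ_{d,p} = ∫_{S^{d-1}} |σ · e|^p dσ`, computed with the unit vector `e`; `dσ` is the surface
measure, normalized so that `dx = r ^ (d - 1) dr dσ` in polar coordinates. -/
def gammaConst {d : ℕ} (p : ℝ) (e : EuclideanSpace ℝ (Fin d)) : ℝ :=
  ∫ σ : Metric.sphere (0 : EuclideanSpace ℝ (Fin d)) 1,
    |inner ℝ (σ : EuclideanSpace ℝ (Fin d)) e| ^ p
      ∂(volume : Measure (EuclideanSpace ℝ (Fin d))).toSphere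

end

/-! Write ν_n for the measure ρ_n(|h|) dh. In polar coordinates its mass is that of the unit sphere
for every n, its mass outside any ball about 0 tends to 0, and it integrates |v·h|^p/|h|^p to γ|v|^p
exactly (`lintegral_inner`).

For fixed h, a weak gradient satisfies u(x+h) - u(x) = ∫₀¹ G(x+th)·h dt for a.e. x
(`ae_sub_eq_integral`). By Jensen and Tonelli, the p-th power of the Taylor remainder over |h|^p,
integrated in x, is at most ∫₀¹ ‖G(·+th) - G‖_p^p dt. This is bounded by (2‖G‖_p)^p and tends to 0
with h, since translations are continuous in L^p. Integrating in ν_n, which concentrates at 0, gives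
the first limit.

For the rest, apply ||a|^p - |b|^p| ≤ ε|b|^p + K|a-b|^p with a = u(x+h) - u(x) and b = G(x)·h.
Integrating in ν_n bounds the gap between D_n and γ|G|^p by εγ|G|^p plus K times the remainder at x
(`exists_nonlocalD_compare`). Integrate in x, choosing ε first and then n. -/

/-! ### Polar coordinates and the measures ρ_n(|h|) dh. -/

/-- The measure `ρ(|h|) dh` on `ℝ^d`. -/
noncomputable def radialMeasure (d : ℕ) (ρ : ℝ → ℝ) : Measure (EuclideanSpace ℝ (Fin d)) :=
  volume.withDensity fun h => ENNReal.ofReal (ρ ‖h‖)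

theorem lintegral_radial_mul_angular {d : ℕ} [NeZero d] {f : ℝ → ℝ≥0∞}
    (hf : AEMeasurable f (volume.restrict (Set.Ioi 0)))
    {g : EuclideanSpace ℝ (Fin d) → ℝ≥0∞} (hg : Measurable g) :
    ∫⁻ h : EuclideanSpace ℝ (Fin d), f ‖h‖ * g (‖h‖⁻¹ • h) =
      (∫⁻ r in Set.Ioi (0 : ℝ), ENNReal.ofReal (r ^ (d - 1)) * f r) *
        ∫⁻ σ : Metric.sphere (0 : EuclideanSpace ℝ (Fin d)) 1, g σ
          ∂(volume : Measure (EuclideanSpace ℝ (Fin d))).toSphere := by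
  have hfc : AEMeasurable (fun r : Set.Ioi (0 : ℝ) => f r)
      (Measure.comap Subtype.val volume) :=
    (MeasurableEmbedding.subtype_coe measurableSet_Ioi).aemeasurable_map_iff.1 (by
      rwa [map_comap_subtype_coe measurableSet_Ioi])
  calc
    ∫⁻ h : EuclideanSpace ℝ (Fin d), f ‖h‖ * g (‖h‖⁻¹ • h)
      = ∫⁻ h : ({(0)}ᶜ : Set (EuclideanSpace ℝ (Fin d))),
          f ‖(h : EuclideanSpace ℝ (Fin d))‖ *
            g (‖(h : EuclideanSpace ℝ (Fin d))‖⁻¹ • (h : EuclideanSpace ℝ (Fin d)))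
            ∂(Measure.comap Subtype.val volume) := by
        rw [lintegral_subtype_comap (measurableSet_singleton _).compl
          (fun h : EuclideanSpace ℝ (Fin d) => f ‖h‖ * g (‖h‖⁻¹ • h)), restrict_compl_singleton]
    _ = ∫⁻ z, f z.2 * g z.1 ∂((volume : Measure (EuclideanSpace ℝ (Fin d))).toSphere.prod
          (Measure.volumeIoiPow (d - 1))) := by
        have := (volume : Measure (EuclideanSpace ℝ
          (Fin d))).measurePreserving_homeomorphUnitSphereProd.lintegral_comp_emb
            (Homeomorph.measurableEmbedding _) (fun z => f z.2 * g z.1)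
        simpa using this
    _ = ∫⁻ z, g z.1 * f z.2 ∂((volume : Measure (EuclideanSpace ℝ (Fin d))).toSphere.prod
          (Measure.volumeIoiPow (d - 1))) := by simp_rw [mul_comm]
    _ = _ := by
        rw [lintegral_prod_mul (μ := (volume : Measure (EuclideanSpace ℝ (Fin d))).toSphere)
          (ν := Measure.volumeIoiPow (d - 1))
          (f := fun σ : Metric.sphere (0 : EuclideanSpace ℝ (Fin d)) 1 => g σ)
          (g := fun r : Set.Ioi (0 : ℝ) => f r)
          (hg.comp measurable_subtype_coe).aemeasurable
          (hfc.mono_ac (withDensity_absolutelyContinuous _ _)), mul_comm]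
        congr 1
        rw [Measure.volumeIoiPow, lintegral_withDensity_eq_lintegral_mul_non_measurable₀ _
          (by fun_prop) (by simp), ← lintegral_subtype_comap measurableSet_Ioi]
        rfl

theorem aemeasurable_comp_norm {d : ℕ} [NeZero d] {ρ : ℝ → ℝ}
    (hρ : IntegrableOn (fun r => ρ r * r ^ (d - 1)) (Set.Ioi 0)) :
    AEMeasurable (fun h : EuclideanSpace ℝ (Fin d) => ENNReal.ofReal (ρ ‖h‖)) := by
  refine AEMeasurable.ennreal_ofReal (Integrable.aemeasurable ?_)
  rw [integrable_fun_norm_addHaar]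
  simpa [mul_comm] using hρ

theorem lintegral_radialMeasure {d : ℕ} [NeZero d] {ρ : ℝ → ℝ}
    (hρ : IntegrableOn (fun r => ρ r * r ^ (d - 1)) (Set.Ioi 0))
    (g : EuclideanSpace ℝ (Fin d) → ℝ≥0∞) :
    ∫⁻ h, g h ∂radialMeasure d ρ = ∫⁻ h, ENNReal.ofReal (ρ ‖h‖) * g h := by
  rw [radialMeasure, lintegral_withDensity_eq_lintegral_mul_non_measurable₀ _
    (aemeasurable_comp_norm hρ) (by simp)]
  rfl

instance {d : ℕ} {ρ : ℝ → ℝ} : SFinite (radialMeasure d ρ) := by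
  unfold radialMeasure; infer_instance

theorem radialMeasure_absolutelyContinuous {d : ℕ} {ρ : ℝ → ℝ} :
    radialMeasure d ρ ≪ volume :=
  withDensity_absolutelyContinuous _ _

theorem lintegral_radialMeasure_angular {d : ℕ} [NeZero d] {ρ : ℝ → ℝ}
    (hm : AEMeasurable ρ (volume.restrict (Set.Ioi 0)))
    (hnn : ∀ᵐ r ∂(volume.restrict (Set.Ioi (0 : ℝ))), 0 ≤ ρ r)
    (hρ : IntegrableOn (fun r => ρ r * r ^ (d - 1)) (Set.Ioi 0))
    {g : EuclideanSpace ℝ (Fin d) → ℝ≥0∞} (hg : Measurable g) :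
    ∫⁻ h, g (‖h‖⁻¹ • h) ∂radialMeasure d ρ =
      ENNReal.ofReal (∫ r in Set.Ioi (0 : ℝ), ρ r * r ^ (d - 1)) *
        ∫⁻ σ : Metric.sphere (0 : EuclideanSpace ℝ (Fin d)) 1, g σ
          ∂(volume : Measure (EuclideanSpace ℝ (Fin d))).toSphere := by
  rw [lintegral_radialMeasure hρ, lintegral_radial_mul_angular hm.ennreal_ofReal hg,
    ofReal_integral_eq_lintegral_ofReal hρ]
  · congr 1
    refine lintegral_congr_ae ?_
    filter_upwards [hnn] with r hr
    rw [mul_comm, ENNReal.ofReal_mul hr]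
  · filter_upwards [hnn, ae_restrict_mem measurableSet_Ioi] with r hr hr0
    have : (0 : ℝ) < r := hr0
    positivity

namespace IsRadialMollifier

variable {d : ℕ} {ρ : ℕ → ℝ → ℝ}

theorem integrableOn (hρ : IsRadialMollifier d ρ) (n : ℕ) :
    IntegrableOn (fun r => ρ n r * r ^ (d - 1)) (Set.Ioi 0) := by
  by_contra h
  have := hρ.integral_eq_one n
  -- The Bochner integral of a non-integrable function is 0 by convention, so unit mass forces
  -- integrability.
  rw [integral_undef h] at this
  exact zero_ne_one this

theorem aemeasurable (hρ : IsRadialMollifier d ρ) (n : ℕ) :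
    AEMeasurable (ρ n) (volume.restrict (Set.Ioi 0)) :=
  (hρ.locallyIntegrableOn n).aestronglyMeasurable.aemeasurable

variable [NeZero d]

theorem lintegral_angular (hρ : IsRadialMollifier d ρ) (n : ℕ)
    {g : EuclideanSpace ℝ (Fin d) → ℝ≥0∞} (hg : Measurable g) :
    ∫⁻ h, g (‖h‖⁻¹ • h) ∂radialMeasure d (ρ n) =
      ∫⁻ σ : Metric.sphere (0 : EuclideanSpace ℝ (Fin d)) 1, g σ
        ∂(volume : Measure (EuclideanSpace ℝ (Fin d))).toSphere := by
  rw [lintegral_radialMeasure_angular (hρ.aemeasurable n) (hρ.nonneg n) (hρ.integrableOn n) hg,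
    hρ.integral_eq_one, ENNReal.ofReal_one, one_mul]

theorem radialMeasure_univ (hρ : IsRadialMollifier d ρ) (n : ℕ) :
    radialMeasure d (ρ n) Set.univ =
      (volume : Measure (EuclideanSpace ℝ (Fin d))).toSphere Set.univ := by
  simpa using hρ.lintegral_angular n (g := fun _ => 1) measurable_const

theorem radialMeasure_tail (hρ : IsRadialMollifier d ρ) {δ : ℝ} (hδ : 0 < δ) :
    Tendsto (fun n => radialMeasure d (ρ n) {h | δ < ‖h‖}) atTop (𝓝 0) := by
  have key : ∀ n, radialMeasure d (ρ n) {h | δ < ‖h‖} =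
      ENNReal.ofReal (∫ r in Set.Ioi δ, ρ n r * r ^ (d - 1)) *
        (volume : Measure (EuclideanSpace ℝ (Fin d))).toSphere Set.univ := fun n => by
    have hind : (fun r => (Set.Ioi δ).indicator (ρ n) r * r ^ (d - 1)) =
        (Set.Ioi δ).indicator (fun r => ρ n r * r ^ (d - 1)) := by
      ext r; by_cases hr : r ∈ Set.Ioi δ <;> simp [hr]
    have hint : IntegrableOn (fun r => (Set.Ioi δ).indicator (ρ n) r * r ^ (d - 1))
        (Set.Ioi 0) := by
      rw [hind]; exact (hρ.integrableOn n).indicator measurableSet_Ioi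
    -- The tail is the total mass of the measure with truncated profile ρ_n 1_{r > δ}, so the polar
    -- formula applies with angular part 1.
    have h := lintegral_radialMeasure_angular (d := d) (ρ := (Set.Ioi δ).indicator (ρ n))
      ((hρ.aemeasurable n).indicator measurableSet_Ioi)
      (by filter_upwards [hρ.nonneg n] with r hr using Set.indicator_apply_nonneg fun _ => hr)
      hint (g := fun _ => 1) measurable_const
    rw [lintegral_radialMeasure hint, hind, setIntegral_indicator measurableSet_Ioi,
      Set.inter_eq_right.2 (Set.Ioi_subset_Ioi hδ.le)] at h
    simp only [mul_one, lintegral_const, one_mul] at h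
    have hs : MeasurableSet {h : EuclideanSpace ℝ (Fin d) | δ < ‖h‖} :=
      measurableSet_lt measurable_const measurable_norm
    rw [← h, radialMeasure, withDensity_apply _ hs, ← lintegral_indicator hs]
    refine lintegral_congr fun x => ?_
    by_cases hx : δ < ‖x‖ <;> simp [hx]
  simp_rw [key]
  have := ENNReal.Tendsto.mul_const (b := (volume : Measure (EuclideanSpace ℝ
    (Fin d))).toSphere Set.univ) (ENNReal.tendsto_ofReal (hρ.tendsto_tail δ hδ))
    (Or.inr (measure_ne_top _ _))
  simpa using this

/-- The integrand depends only on the direction of h, which settles v = e. Rotation invariance and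
p-homogeneity reduce any v to that case. -/
theorem lintegral_inner (hρ : IsRadialMollifier d ρ) (n : ℕ) {p : ℝ} (hp : 0 < p)
    {e : EuclideanSpace ℝ (Fin d)} (he : ‖e‖ = 1) (v : EuclideanSpace ℝ (Fin d)) :
    ∫⁻ h, ENNReal.ofReal (|inner ℝ v h| ^ p / ‖h‖ ^ p) ∂radialMeasure d (ρ n) =
      ENNReal.ofReal (gammaConst p e * ‖v‖ ^ p) := by
  have hunit : ∫⁻ h, ENNReal.ofReal (|inner ℝ e h| ^ p / ‖h‖ ^ p) ∂radialMeasure d (ρ n) =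
      ENNReal.ofReal (gammaConst p e) := by
    have h1 := hρ.lintegral_angular n
      (g := fun h => ENNReal.ofReal (|inner ℝ h e| ^ p)) (by fun_prop)
    rw [gammaConst, ofReal_integral_eq_lintegral_ofReal, ← h1]
    · refine lintegral_congr fun h => ?_
      rw [inner_smul_left, abs_mul, Real.mul_rpow (by positivity) (by positivity),
        real_inner_comm]
      simp [Real.inv_rpow, div_eq_inv_mul]
    · refine Integrable.of_bound (C := 1) (by
        refine Measurable.aestronglyMeasurable ?_
        fun_prop) (ae_of_all _ fun σ => ?_)
      rw [Real.norm_of_nonneg (by positivity)]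
      refine Real.rpow_le_one (abs_nonneg _) ?_ hp.le
      refine (abs_real_inner_le_norm _ _).trans ?_
      simp [he]
    · exact ae_of_all _ fun σ => by positivity
  have hrot : ∫⁻ h, ENNReal.ofReal (|inner ℝ (‖v‖ • e) h| ^ p / ‖h‖ ^ p)
      ∂radialMeasure d (ρ n) =
      ∫⁻ h, ENNReal.ofReal (|inner ℝ v h| ^ p / ‖h‖ ^ p) ∂radialMeasure d (ρ n) := by
    have hn : ‖v‖ = ‖‖v‖ • e‖ := by simp [norm_smul, he]
    -- Since v and ‖v‖e have equal norms, the reflection in the hyperplane orthogonal to their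
    -- difference carries one to the other.
    set R := (Submodule.span ℝ {v - ‖v‖ • e})ᗮ.reflection
    have hR : R v = ‖v‖ • e := Submodule.reflection_sub hn
    rw [lintegral_radialMeasure (hρ.integrableOn n), lintegral_radialMeasure (hρ.integrableOn n),
      ← R.measurePreserving.lintegral_comp_emb R.toHomeomorph.measurableEmbedding, ← hR]
    simp
  rw [← hrot]
  have : ∀ h : EuclideanSpace ℝ (Fin d),
      ENNReal.ofReal (|inner ℝ (‖v‖ • e) h| ^ p / ‖h‖ ^ p) =
        ENNReal.ofReal (‖v‖ ^ p) * ENNReal.ofReal (|inner ℝ e h| ^ p / ‖h‖ ^ p) := fun h => by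
    rw [← ENNReal.ofReal_mul (by positivity), inner_smul_left, abs_mul,
      Real.mul_rpow (by positivity) (by positivity), mul_div_assoc]
    simp
  simp_rw [this]
  rw [lintegral_const_mul _ (by fun_prop), hunit, ← ENNReal.ofReal_mul (by positivity), mul_comm]

end IsRadialMollifier

/-! ### Continuity of translations in L^q. -/

theorem MeasureTheory.MemLp.tendsto_eLpNorm_translate_sub {E F : Type*} [NormedAddCommGroup E]
    [NormedSpace ℝ E] [FiniteDimensional ℝ E] [MeasurableSpace E] [BorelSpace E]
    [NormedAddCommGroup F] {μ : Measure E} [μ.IsAddHaarMeasure] {q : ℝ≥0∞} [Fact (1 ≤ q)]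
    (hq : q ≠ ⊤) {G : E → F} (hG : MemLp G q μ) :
    Tendsto (fun k => eLpNorm (fun x => G (x + k) - G x) q μ) (𝓝 0) (𝓝 0) := by
  have : Fact (q ≠ ⊤) := ⟨hq⟩
  have hc : Continuous fun k : E => DomAddAct.mk k +ᵥ hG.toLp G := by
    have h1 : Continuous fun k : E => DomAddAct.mk k := continuous_induced_rng.2 continuous_id
    exact h1.vadd continuous_const
  have h0 := hc.tendsto 0
  have hG' : ∀ k : E, MemLp (fun x => G (k +ᵥ x)) q μ := fun k =>
    hG.comp_measurePreserving (measurePreserving_vadd k μ)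
  -- The action on L^q is by definition precomposition with translation.
  have h2 : Tendsto (fun k => (hG' k).toLp) (𝓝 (0 : E)) (𝓝 ((hG' 0).toLp)) := h0
  rw [Lp.tendsto_Lp_iff_tendsto_eLpNorm''] at h2
  refine h2.congr fun k => ?_
  congr 1
  ext x
  simp [add_comm]

/-! ### The fundamental theorem of calculus along segments for weak gradients. -/

section WeakGradient

variable {d : ℕ}

local notation "𝔼" => EuclideanSpace ℝ (Fin d)

theorem measurePreserving_shear (h : 𝔼) :
    MeasurePreserving (fun z : ℝ × 𝔼 => (z.1, z.2 + z.1 • h))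
      ((volume.restrict (Set.Icc (0 : ℝ) 1)).prod volume)
      ((volume.restrict (Set.Icc (0 : ℝ) 1)).prod volume) :=
  MeasurePreserving.skew_product (g := fun t x => x + t • h) (MeasurePreserving.id _)
    (by fun_prop) (ae_of_all _ fun t => map_add_right_eq_self _ _)

theorem integrable_shear {F : 𝔼 → ℝ} (hF : LocallyIntegrable F) (h : 𝔼) {K : Set 𝔼}
    (hK : IsCompact K) :
    Integrable (fun z : ℝ × 𝔼 => F (z.2 + z.1 • h))
      ((volume.restrict (Set.Icc (0 : ℝ) 1)).prod (volume.restrict K)) := by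
  -- The compact set swept out by K: cutting F off there makes it integrable without changing the
  -- values that occur.
  set K' : Set 𝔼 := (fun z : ℝ × 𝔼 => z.2 + z.1 • h) '' (Set.Icc (0 : ℝ) 1 ×ˢ K)
  have hK' : IsCompact K' := (isCompact_Icc.prod hK).image (by fun_prop)
  have h1 : Integrable (K'.indicator F) :=
    (hF.integrableOn_isCompact hK').integrable_indicator hK'.measurableSet
  have h2 : Integrable (fun z : ℝ × 𝔼 => K'.indicator F z.2)
      ((volume.restrict (Set.Icc (0 : ℝ) 1)).prod volume) := h1.comp_snd _
  have h3 := (measurePreserving_shear h).integrable_comp_of_integrable h2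
  have h4 : Integrable (fun z : ℝ × 𝔼 => K'.indicator F (z.2 + z.1 • h))
      ((volume.restrict (Set.Icc (0 : ℝ) 1)).prod (volume.restrict K)) :=
    h3.mono_measure (Measure.prod_mono le_rfl Measure.restrict_le_self)
  refine h4.congr ?_
  rw [Measure.prod_restrict]
  filter_upwards [ae_restrict_mem (measurableSet_Icc.prod hK.measurableSet)] with z hz
  exact Set.indicator_of_mem (Set.mem_image_of_mem _ hz) _

theorem locallyIntegrable_segmentIntegral {F : 𝔼 → ℝ} (hF : LocallyIntegrable F) (h : 𝔼) :
    LocallyIntegrable fun x => ∫ t in Set.Icc (0 : ℝ) 1, F (x + t • h) := by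
  rw [locallyIntegrable_iff]
  intro K hK
  exact (integrable_shear hF h hK).integral_prod_right

theorem integrable_mul_shear {F : 𝔼 → ℝ} (hF : LocallyIntegrable F) (h : 𝔼) {ψ : 𝔼 → ℝ}
    (hψ : Continuous ψ) (hs : HasCompactSupport ψ) :
    Integrable (fun z : ℝ × 𝔼 => ψ z.2 * F (z.2 + z.1 • h))
      ((volume.restrict (Set.Icc (0 : ℝ) 1)).prod volume) := by
  obtain ⟨C, hC⟩ := hψ.bounded_above_of_compact_support hs
  have h1 := (integrable_shear hF h hs.isCompact).bdd_mul (c := C)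
    (hψ.comp continuous_snd).aestronglyMeasurable (ae_of_all _ fun z => hC z.2)
  have h2 : IntegrableOn (fun z : ℝ × 𝔼 => ψ z.2 * F (z.2 + z.1 • h)) (Set.univ ×ˢ tsupport ψ)
      ((volume.restrict (Set.Icc (0 : ℝ) 1)).prod volume) := by
    rw [IntegrableOn, ← Measure.prod_restrict, Measure.restrict_univ]
    exact h1
  refine h2.integrable_of_forall_notMem_eq_zero fun z hz => ?_
  have : z.2 ∉ tsupport ψ := fun h => hz ⟨trivial, h⟩
  rw [image_eq_zero_of_notMem_tsupport this, zero_mul]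

theorem integrable_mul_shear_sub {F : 𝔼 → ℝ} (hF : LocallyIntegrable F) (h : 𝔼) {ψ : 𝔼 → ℝ}
    (hψ : Continuous ψ) (hs : HasCompactSupport ψ) :
    Integrable (fun z : ℝ × 𝔼 => ψ (z.2 - z.1 • h) * F z.2)
      ((volume.restrict (Set.Icc (0 : ℝ) 1)).prod volume) := by
  have h1 := (measurePreserving_shear (-h)).integrable_comp_of_integrable
    (integrable_mul_shear hF h hψ hs)
  refine h1.congr (ae_of_all _ fun z => ?_)
  simp [sub_eq_add_neg]

theorem integral_mul_segmentIntegral {F : 𝔼 → ℝ} (hF : LocallyIntegrable F) (h : 𝔼)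
    {ψ : 𝔼 → ℝ} (hψ : Continuous ψ) (hs : HasCompactSupport ψ) :
    ∫ x, ψ x * ∫ t in Set.Icc (0 : ℝ) 1, F (x + t • h) =
      ∫ t in Set.Icc (0 : ℝ) 1, ∫ x, ψ (x - t • h) * F x := by
  simp_rw [← integral_const_mul]
  rw [integral_integral_swap (f := fun x (t : ℝ) => ψ x * F (x + t • h))
    (integrable_mul_shear hF h hψ hs).swap]
  refine integral_congr_ae (ae_of_all _ fun t => ?_)
  simpa using (integral_add_right_eq_self (μ := (volume : Measure 𝔼))
    (fun x => ψ (x - t • h) * F x) (t • h))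

theorem MeasureTheory.LocallyIntegrable.comp_add_right {u : 𝔼 → ℝ} (hu : LocallyIntegrable u)
    (h : 𝔼) : LocallyIntegrable fun x => u (x + h) := by
  rw [locallyIntegrable_iff]
  intro K hK
  have h1 := hu.integrableOn_isCompact (hK.image (continuous_add_const h))
  have h2 := ((measurePreserving_add_right (volume : Measure 𝔼) h).integrableOn_comp_preimage
    (measurableEmbedding_addRight h)).2 h1
  rwa [Set.preimage_image_eq _ (add_left_injective h)] at h2

theorem MeasureTheory.LocallyIntegrable.integrable_mul_of_hasCompactSupport {u : 𝔼 → ℝ}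
    (hu : LocallyIntegrable u) {ψ : 𝔼 → ℝ} (hψ : Continuous ψ) (hs : HasCompactSupport ψ) :
    Integrable fun x => ψ x * u x := by
  simpa using hu.integrable_smul_left_of_hasCompactSupport hψ hs

theorem HasWeakGradient.locallyIntegrable_inner {u : 𝔼 → ℝ} {G : 𝔼 → 𝔼}
    (hG : HasWeakGradient u G) (h : 𝔼) : LocallyIntegrable fun x => inner ℝ (G x) h := by
  rw [locallyIntegrable_iff]
  intro K hK
  exact (hG.locallyIntegrable_grad.integrableOn_isCompact hK).inner_const h

theorem HasWeakGradient.integral_mul_fderiv {u : 𝔼 → ℝ} {G : 𝔼 → 𝔼} (hG : HasWeakGradient u G)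
    {φ : 𝔼 → ℝ} (hφ : ContDiff ℝ ∞ φ) (hs : HasCompactSupport φ) (h : 𝔼) :
    ∫ x, fderiv ℝ φ x h * u x = - ∫ x, φ x * inner ℝ (G x) h := by
  have hcoord : ∀ i x, G x i = inner ℝ (G x) (EuclideanSpace.single i (1 : ℝ)) := fun i x => by
    simp [EuclideanSpace.inner_single_right]
  have hh : h = ∑ i, h i • EuclideanSpace.single i (1 : ℝ) := by
    ext j; simp [Pi.single_apply]
  have hfd : ∀ v, Continuous fun x => fderiv ℝ φ x v := fun v =>
    (hφ.continuous_fderiv (by simp)).clm_apply continuous_const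
  have h1 : ∀ x, fderiv ℝ φ x h * u x =
      ∑ i, h i * (fderiv ℝ φ x (EuclideanSpace.single i 1) * u x) := fun x => by
    conv_lhs => rw [hh]
    simp [Finset.sum_mul, mul_assoc]
  have h2 : ∀ x, φ x * inner ℝ (G x) h = ∑ i, h i * (φ x * G x i) := fun x => by
    conv_lhs => rw [hh]
    simp only [inner_sum, inner_smul_right, ← hcoord, Finset.mul_sum]
    exact Finset.sum_congr rfl fun i _ => by ring
  simp_rw [h1, h2]
  rw [integral_finsetSum, integral_finsetSum, ← Finset.sum_neg_distrib]
  · refine Finset.sum_congr rfl fun i _ => ?_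
    rw [integral_const_mul, integral_const_mul, ← mul_neg, ← hG.integral_eq φ hφ hs i]
    simp_rw [mul_comm]
  · intro i _
    simp_rw [hcoord]
    exact ((hG.locallyIntegrable_inner _).integrable_mul_of_hasCompactSupport
      hφ.continuous hs).const_mul _
  · intro i _
    exact (hG.locallyIntegrable.integrable_mul_of_hasCompactSupport (hfd _)
      (hs.fderiv_apply (𝕜 := ℝ) _)).const_mul _

theorem integral_fderiv_segment {φ : 𝔼 → ℝ} (hφ : ContDiff ℝ ∞ φ) (x h : 𝔼) :
    ∫ t in Set.Icc (0 : ℝ) 1, fderiv ℝ φ (x - t • h) h = φ x - φ (x - h) := by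
  rw [integral_Icc_eq_integral_Ioc, ← intervalIntegral.integral_of_le zero_le_one]
  have hd : ∀ t ∈ Set.uIcc (0 : ℝ) 1,
      HasDerivAt (fun t : ℝ => - φ (x - t • h)) (fderiv ℝ φ (x - t • h) h) t := fun t _ => by
    have h1 : HasDerivAt (fun t : ℝ => x - t • h) (-h) t := by
      simpa using ((hasDerivAt_id t).smul_const h).const_sub x
    have h2 := ((hφ.differentiable (by simp)) (x - t • h)).hasFDerivAt.comp_hasDerivAt t h1
    simpa [Function.comp_def] using h2.fun_neg
  rw [intervalIntegral.integral_eq_sub_of_hasDerivAt hd]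
  · simp; ring
  · refine Continuous.intervalIntegrable ?_ _ _
    have := hφ.continuous_fderiv (by simp)
    fun_prop

/-- Test both sides against φ. On the right, Fubini and translation move the shift onto φ, the weak
gradient identity turns G into u, and the classical fundamental theorem for φ integrates out t. What
remains is the left side after a change of variable. -/
theorem HasWeakGradient.ae_sub_eq_integral {u : 𝔼 → ℝ} {G : 𝔼 → 𝔼} (hG : HasWeakGradient u G)
    (h : 𝔼) : ∀ᵐ x, u (x + h) - u x = ∫ t in Set.Icc (0 : ℝ) 1, inner ℝ (G (x + t • h)) h := by
  have hF := hG.locallyIntegrable_inner h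
  have hu := hG.locallyIntegrable
  refine ae_eq_of_integral_contDiff_smul_eq ((hu.comp_add_right h).sub hu)
    (locallyIntegrable_segmentIntegral hF h) fun φ hφ hs => ?_
  have hφc := hφ.continuous
  have hDc : Continuous fun x => fderiv ℝ φ x h :=
    (hφ.continuous_fderiv (by simp)).clm_apply continuous_const
  have hDs : HasCompactSupport fun x => fderiv ℝ φ x h := hs.fderiv_apply (𝕜 := ℝ) _
  have hweak : ∀ t : ℝ, ∫ x, φ (x - t • h) * inner ℝ (G x) h =
      - ∫ x, fderiv ℝ φ (x - t • h) h * u x := fun t => by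
    have := hG.integral_mul_fderiv (φ := fun x => φ (x - t • h)) (by fun_prop)
      (hs.comp_homeomorph (Homeomorph.subRight (t • h))) h
    simp only [fderiv_comp_sub] at this
    rw [this, neg_neg]
  have hi1 := (hu.comp_add_right h).integrable_mul_of_hasCompactSupport hφc hs
  have hi2 := hu.integrable_mul_of_hasCompactSupport hφc hs
  have hi3 := hu.integrable_mul_of_hasCompactSupport (ψ := fun x => φ (x - h)) (by fun_prop)
    (hs.comp_homeomorph (Homeomorph.subRight h))
  simp only [smul_eq_mul]
  rw [integral_mul_segmentIntegral hF h hφc hs]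
  simp_rw [hweak]
  rw [integral_neg, integral_integral_swap (integrable_mul_shear_sub hu h hDc hDs)]
  simp_rw [integral_mul_const, integral_fderiv_segment hφ, sub_mul, mul_sub]
  rw [integral_sub hi1 hi2, integral_sub hi2 hi3, neg_sub]
  congr 1
  simpa using (integral_add_right_eq_self (μ := (volume : Measure 𝔼))
    (fun x => φ (x - h) * u x) h)

end WeakGradient

/-! ### Concentrating measures and elementary inequalities. -/

theorem tendsto_lintegral_of_concentrating {E : Type*} [NormedAddCommGroup E] [MeasurableSpace E]
    [OpensMeasurableSpace E] {ν : ℕ → Measure E} {M : ℝ≥0∞} (hM : M ≠ ⊤)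
    (hν : ∀ n, ν n Set.univ ≤ M)
    (htail : ∀ δ : ℝ, 0 < δ → Tendsto (fun n => ν n {h | δ < ‖h‖}) atTop (𝓝 0))
    {Φ : E → ℝ≥0∞} {C : ℝ≥0∞} (hC : C ≠ ⊤) (hΦC : ∀ h, Φ h ≤ C) (hΦ : Tendsto Φ (𝓝 0) (𝓝 0)) :
    Tendsto (fun n => ∫⁻ h, Φ h ∂ν n) atTop (𝓝 0) := by
  rw [ENNReal.tendsto_nhds_zero]
  intro ε hε
  have hη : Tendsto (fun η : ℝ≥0∞ => η * M) (𝓝[>] 0) (𝓝 0) := by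
    have := ENNReal.Tendsto.mul_const (b := M) (tendsto_id (α := ℝ≥0∞) (x := 𝓝 0)) (Or.inr hM)
    rw [zero_mul] at this
    exact this.mono_left nhdsWithin_le_nhds
  have hε2 : 0 < ε / 2 := ENNReal.half_pos hε.ne'
  obtain ⟨η, hηM, hη0⟩ :=
    ((hη.eventually_le_const hε2).and (eventually_mem_nhdsWithin)).exists
  obtain ⟨δ, hδ, hδΦ⟩ := Metric.eventually_nhds_iff.1 (hΦ.eventually_le_const hη0)
  -- Cutting at δ/2 makes the complement ‖h‖ ≤ δ/2 lie in the open ball of radius δ, where Φ ≤ η.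
  have ht := ENNReal.Tendsto.const_mul (a := C) (htail (δ / 2) (half_pos hδ)) (Or.inr hC)
  rw [mul_zero] at ht
  filter_upwards [ht.eventually_le_const hε2] with n hn
  have hs : MeasurableSet {h : E | δ / 2 < ‖h‖} :=
    (isOpen_lt continuous_const continuous_norm).measurableSet
  calc
    ∫⁻ h, Φ h ∂ν n ≤ ∫⁻ h, (η + {h : E | δ / 2 < ‖h‖}.indicator (fun _ => C) h) ∂ν n := by
        refine lintegral_mono fun h => ?_
        by_cases hh : δ / 2 < ‖h‖
        · simpa [hh] using (hΦC h).trans le_add_self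
        · refine (hδΦ ?_).trans le_self_add
          rw [dist_zero_right]
          linarith
    _ = η * ν n Set.univ + C * ν n {h | δ / 2 < ‖h‖} := by
        rw [lintegral_add_left measurable_const, lintegral_const, lintegral_indicator_const hs]
    _ ≤ ε / 2 + ε / 2 := add_le_add ((mul_le_mul_right (hν n) η).trans hηM) hn
    _ = ε := ENNReal.add_halves ε

theorem lintegral_enorm_rpow_eq_eLpNorm {α F : Type*} [MeasurableSpace α] [NormedAddCommGroup F]
    {μ : Measure α} {p : ℝ} (hp : 1 ≤ p) (f : α → F) :
    ∫⁻ x, ‖f x‖ₑ ^ p ∂μ = eLpNorm f (ENNReal.ofReal p) μ ^ p := by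
  have hp0 : 0 < p := by linarith
  rw [eLpNorm_eq_lintegral_rpow_enorm_toReal (by simpa using hp0) ENNReal.ofReal_ne_top,
    ENNReal.toReal_ofReal hp0.le, ← ENNReal.rpow_mul, one_div, inv_mul_cancel₀ hp0.ne',
    ENNReal.rpow_one]

theorem lintegral_enorm_rpow_le {α F : Type*} [MeasurableSpace α] [NormedAddCommGroup F]
    {μ : Measure α} [IsProbabilityMeasure μ] {p : ℝ} (hp : 1 ≤ p) {f : α → F}
    (hf : AEStronglyMeasurable f μ) :
    (∫⁻ x, ‖f x‖ₑ ∂μ) ^ p ≤ ∫⁻ x, ‖f x‖ₑ ^ p ∂μ := by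
  rw [lintegral_enorm_rpow_eq_eLpNorm hp, ← eLpNorm_one_eq_lintegral_enorm]
  gcongr
  exact eLpNorm_le_eLpNorm_of_exponent_le (by simpa using hp) hf

theorem enorm_integral_sub_le {α F : Type*} [MeasurableSpace α] [NormedAddCommGroup F]
    [NormedSpace ℝ F] [CompleteSpace F] {μ : Measure α} [IsProbabilityMeasure μ] {f : α → F}
    (hf : AEStronglyMeasurable f μ) (c : F) :
    ‖∫ x, f x ∂μ - c‖ₑ ≤ ∫⁻ x, ‖f x - c‖ₑ ∂μ := by
  by_cases hi : Integrable f μ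
  · have : ∫ x, f x ∂μ - c = ∫ x, (f x - c) ∂μ := by
      rw [integral_sub hi (integrable_const c)]; simp
    rw [this]
    exact enorm_integral_le_lintegral_enorm _
  -- Without integrability the left integral defaults to 0, but the right side is infinite because
  -- constants are integrable.
  · have : ∫⁻ x, ‖f x - c‖ₑ ∂μ = ⊤ := by
      by_contra h
      refine hi ?_
      have h1 : Integrable (fun x => f x - c) μ :=
        ⟨hf.sub aestronglyMeasurable_const, lt_top_iff_ne_top.2 h⟩
      exact (h1.add (integrable_const c)).congr (ae_of_all _ fun x => sub_add_cancel _ _)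
    rw [this]
    exact le_top

/-- If |a-b| ≤ η|b|, then |a| lies between (1-η)|b| and (1+η)|b|, and a small η gives the ε term.
Otherwise |a| and |b| are both at most (1+η⁻¹)|a-b|, which dictates K. -/
theorem exists_abs_rpow_sub_le {p : ℝ} (hp : 0 < p) {ε : ℝ} (hε : 0 < ε) :
    ∃ K : ℝ, 0 ≤ K ∧ ∀ a b : ℝ, |a| ^ p ≤ |b| ^ p + (ε * |b| ^ p + K * |a - b| ^ p) ∧
      |b| ^ p ≤ |a| ^ p + (ε * |b| ^ p + K * |a - b| ^ p) := by
  have hc1 : Tendsto (fun η : ℝ => (1 + η) ^ p) (𝓝[>] 0) (𝓝 1) := by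
    have : ContinuousAt (fun η : ℝ => (1 + η) ^ p) 0 :=
      (continuousAt_const.add continuousAt_id).rpow_const (Or.inr hp.le)
    simpa using this.tendsto.mono_left nhdsWithin_le_nhds
  have hc2 : Tendsto (fun η : ℝ => (1 - η) ^ p) (𝓝[>] 0) (𝓝 1) := by
    have : ContinuousAt (fun η : ℝ => (1 - η) ^ p) 0 :=
      (continuousAt_const.sub continuousAt_id).rpow_const (Or.inr hp.le)
    simpa using this.tendsto.mono_left nhdsWithin_le_nhds
  have hc3 : ∀ᶠ η : ℝ in 𝓝[>] 0, η < 1 :=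
    (eventually_lt_nhds zero_lt_one).filter_mono nhdsWithin_le_nhds
  obtain ⟨η, h1, h2, h3, h0⟩ := ((hc1.eventually_le_const (show 1 < 1 + ε by linarith)).and
    ((hc2.eventually_const_le (show 1 - ε < 1 by linarith)).and
      (hc3.and eventually_mem_nhdsWithin))).exists
  have h0 : 0 < η := h0
  refine ⟨(1 + η⁻¹) ^ p, by positivity, fun a b => ?_⟩
  have hab : |a| ≤ |b| + |a - b| := by
    simpa using abs_add_le b (a - b)
  have hba : |b| ≤ |a| + |a - b| := by
    simpa [abs_sub_comm] using abs_add_le a (b - a)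
  have hap : 0 ≤ |a| ^ p := by positivity
  have hbp : 0 ≤ |b| ^ p := by positivity
  have hcp : 0 ≤ |a - b| ^ p := by positivity
  rcases le_total |a - b| (η * |b|) with hc | hc
  · have hK : 0 ≤ (1 + η⁻¹) ^ p * |a - b| ^ p := by positivity
    have e1 : |a| ^ p ≤ (1 + η) ^ p * |b| ^ p := by
      rw [← Real.mul_rpow (by positivity) (abs_nonneg _)]
      exact Real.rpow_le_rpow (abs_nonneg _) (by linarith) hp.le
    have e2 : (1 - η) ^ p * |b| ^ p ≤ |a| ^ p := by
      rw [← Real.mul_rpow (by linarith) (abs_nonneg _)]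
      exact Real.rpow_le_rpow (mul_nonneg (by linarith) (abs_nonneg _)) (by linarith) hp.le
    have e3 := mul_le_mul_of_nonneg_right h1 hbp
    have e4 := mul_le_mul_of_nonneg_right h2 hbp
    constructor <;> linarith
  · have hb : |b| ≤ η⁻¹ * |a - b| := by
      rw [← div_eq_inv_mul, le_div_iff₀ h0, mul_comm]; exact hc
    have hεb : 0 ≤ ε * |b| ^ p := by positivity
    have e1 : |a| ^ p ≤ (1 + η⁻¹) ^ p * |a - b| ^ p := by
      rw [← Real.mul_rpow (by positivity) (abs_nonneg _)]
      exact Real.rpow_le_rpow (abs_nonneg _) (by linarith) hp.le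
    have e2 : |b| ^ p ≤ (1 + η⁻¹) ^ p * |a - b| ^ p := by
      rw [← Real.mul_rpow (by positivity) (abs_nonneg _)]
      exact Real.rpow_le_rpow (abs_nonneg _) (by linarith [abs_nonneg (a - b)]) hp.le
    constructor <;> linarith

theorem ENNReal.enorm_toReal_sub_toReal_le {a b c : ℝ≥0∞} (hb : b ≠ ⊤) (hab : a ≤ b + c)
    (hba : b ≤ a + c) : ‖a.toReal - b.toReal‖ₑ ≤ c := by
  rcases eq_or_ne c ⊤ with rfl | hc
  -- An infinite error bound is trivial, so the comparison can be used at every x, without first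
  -- excluding points of infinite remainder.
  · exact le_top
  have ha : a ≠ ⊤ := ne_top_of_le_ne_top (ENNReal.add_ne_top.2 ⟨hb, hc⟩) hab
  have h1 := ENNReal.toReal_mono (ENNReal.add_ne_top.2 ⟨hb, hc⟩) hab
  have h2 := ENNReal.toReal_mono (ENNReal.add_ne_top.2 ⟨ha, hc⟩) hba
  rw [ENNReal.toReal_add hb hc] at h1
  rw [ENNReal.toReal_add ha hc] at h2
  rw [← ofReal_norm, Real.norm_eq_abs]
  exact ENNReal.ofReal_le_of_le_toReal (abs_le.2 ⟨by linarith, by linarith⟩)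

/-! ### The Taylor remainder at a fixed shift h. -/

section DifferenceQuotient

variable {d : ℕ}

local notation "𝔼" => EuclideanSpace ℝ (Fin d)

theorem ofReal_abs_rpow_div_norm_rpow_le {p : ℝ} (hp : 0 < p) {a : ℝ} {h : 𝔼} {c : ℝ≥0∞}
    (ha : ‖a‖ₑ ^ p ≤ ‖h‖ₑ ^ p * c) : ENNReal.ofReal (|a| ^ p / ‖h‖ ^ p) ≤ c := by
  rcases eq_or_ne h 0 with rfl | hh
  -- At h = 0 the quotient is 0, by division by zero.
  · simp [Real.zero_rpow hp.ne']
  have hn : 0 < ‖h‖ := norm_pos_iff.2 hh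
  rw [ENNReal.ofReal_div_of_pos (by positivity), ← ENNReal.ofReal_rpow_of_nonneg (by positivity)
    hp.le, ← ENNReal.ofReal_rpow_of_nonneg (by positivity) hp.le, ← Real.norm_eq_abs,
    ofReal_norm, ofReal_norm]
  refine ENNReal.div_le_of_le_mul ?_
  rwa [mul_comm]

/-- The remainder is the average over the segment of (G(x+th) - G(x))·h. Cauchy–Schwarz extracts
|h|, which cancels the denominator; Jensen on [0,1] and Tonelli finish. -/
theorem HasWeakGradient.lintegral_remainder_le {u : 𝔼 → ℝ} {G : 𝔼 → 𝔼}
    (hG : HasWeakGradient u G) (hGm : Measurable G) {p : ℝ} (hp : 1 ≤ p) (h : 𝔼) :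
    ∫⁻ x, ENNReal.ofReal (|u (x + h) - u x - inner ℝ (G x) h| ^ p / ‖h‖ ^ p) ≤
      ∫⁻ t in Set.Icc (0 : ℝ) 1,
        eLpNorm (fun x => G (x + t • h) - G x) (ENNReal.ofReal p) volume ^ p := by
  have : IsProbabilityMeasure (volume.restrict (Set.Icc (0 : ℝ) 1)) := ⟨by simp⟩
  have hp0 : 0 < p := by linarith
  calc
    _ ≤ ∫⁻ x, ∫⁻ t in Set.Icc (0 : ℝ) 1, ‖G (x + t • h) - G x‖ₑ ^ p := by
      refine lintegral_mono_ae ?_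
      filter_upwards [hG.ae_sub_eq_integral h] with x hx
      refine ofReal_abs_rpow_div_norm_rpow_le hp0 ?_
      have hm : Measurable fun t : ℝ => G (x + t • h) := by fun_prop
      have e1 : ‖u (x + h) - u x - inner ℝ (G x) h‖ₑ ≤
          ‖h‖ₑ * ∫⁻ t in Set.Icc (0 : ℝ) 1, ‖G (x + t • h) - G x‖ₑ := by
        rw [hx, ← lintegral_const_mul _ (by fun_prop)]
        refine (enorm_integral_sub_le
          (hm.inner measurable_const).aestronglyMeasurable _).trans (lintegral_mono fun t => ?_)
        rw [← inner_sub_left, mul_comm]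
        simp_rw [← ofReal_norm]
        rw [← ENNReal.ofReal_mul (norm_nonneg _)]
        exact ENNReal.ofReal_le_ofReal (norm_inner_le_norm _ _)
      calc
        _ ≤ (‖h‖ₑ * ∫⁻ t in Set.Icc (0 : ℝ) 1, ‖G (x + t • h) - G x‖ₑ) ^ p := by gcongr
        _ ≤ _ := by
          rw [ENNReal.mul_rpow_of_nonneg _ _ hp0.le]
          gcongr
          exact lintegral_enorm_rpow_le hp (hm.sub_const _).aestronglyMeasurable
    _ = ∫⁻ t in Set.Icc (0 : ℝ) 1, ∫⁻ x, ‖G (x + t • h) - G x‖ₑ ^ p :=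
      lintegral_lintegral_swap (by unfold Function.uncurry; fun_prop)
    _ = _ := by simp_rw [lintegral_enorm_rpow_eq_eLpNorm hp]

theorem HasWeakGradient.lintegral_remainder_le_const {u : 𝔼 → ℝ} {G : 𝔼 → 𝔼}
    (hG : HasWeakGradient u G) (hGm : Measurable G) {p : ℝ} (hp : 1 ≤ p) (h : 𝔼) :
    ∫⁻ x, ENNReal.ofReal (|u (x + h) - u x - inner ℝ (G x) h| ^ p / ‖h‖ ^ p) ≤
      (2 * eLpNorm G (ENNReal.ofReal p) volume) ^ p := by
  refine (hG.lintegral_remainder_le hGm hp h).trans ?_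
  calc
    _ ≤ ∫⁻ t in Set.Icc (0 : ℝ) 1, (2 * eLpNorm G (ENNReal.ofReal p) volume) ^ p := by
      refine lintegral_mono fun t => ?_
      gcongr
      have h1 : eLpNorm (fun x => G (x + t • h)) (ENNReal.ofReal p) volume =
          eLpNorm G (ENNReal.ofReal p) volume :=
        eLpNorm_comp_measurePreserving hGm.aestronglyMeasurable
          (measurePreserving_add_right volume (t • h))
      refine (eLpNorm_sub_le (hGm.comp (measurable_add_const _)).aestronglyMeasurable
        hGm.aestronglyMeasurable (by simpa using hp)).trans ?_
      rw [Function.comp_def, h1, two_mul]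
    _ = _ := by simp

theorem HasWeakGradient.tendsto_lintegral_remainder {u : 𝔼 → ℝ} {G : 𝔼 → 𝔼}
    (hG : HasWeakGradient u G) (hGm : Measurable G) {p : ℝ} (hp : 1 ≤ p)
    (hGp : MemLp G (ENNReal.ofReal p) volume) :
    Tendsto (fun h : 𝔼 => ∫⁻ x,
      ENNReal.ofReal (|u (x + h) - u x - inner ℝ (G x) h| ^ p / ‖h‖ ^ p)) (𝓝 0) (𝓝 0) := by
  have : Fact (1 ≤ ENNReal.ofReal p) := ⟨by simpa using hp⟩
  have hp0 : 0 < p := by linarith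
  have h1 : Tendsto (fun k => eLpNorm (fun x => G (x + k) - G x) (ENNReal.ofReal p) volume ^ p)
      (𝓝 0) (𝓝 0) := by
    simpa [hp0] using (hGp.tendsto_eLpNorm_translate_sub ENNReal.ofReal_ne_top).ennrpow_const p
  rw [ENNReal.tendsto_nhds_zero]
  intro ε hε
  obtain ⟨δ, hδ, hb⟩ := Metric.eventually_nhds_iff.1 (h1.eventually_le_const hε)
  filter_upwards [Metric.ball_mem_nhds (0 : 𝔼) hδ] with h hh
  refine (hG.lintegral_remainder_le hGm hp h).trans ?_
  calc
    _ ≤ ∫⁻ t in Set.Icc (0 : ℝ) 1, ε := by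
      refine setLIntegral_mono measurable_const fun t ht => hb ?_
      rw [dist_zero_right, norm_smul, Real.norm_of_nonneg ht.1]
      have := mem_ball_zero_iff.1 hh
      nlinarith [norm_nonneg h, ht.1, ht.2]
    _ = ε := by simp

end DifferenceQuotient

/-! ### Independence of representatives, and measurability in x. -/

theorem MeasureTheory.LocallyIntegrable.congr_ae {d : ℕ} {F : Type*} [NormedAddCommGroup F]
    {f g : EuclideanSpace ℝ (Fin d) → F} (hf : LocallyIntegrable f) (hfg : f =ᵐ[volume] g) :
    LocallyIntegrable g := by
  rw [locallyIntegrable_iff] at hf ⊢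
  intro K hK
  exact (hf K hK).congr_fun_ae (ae_restrict_of_ae hfg)

theorem HasWeakGradient.congr_ae {d : ℕ} {u u' : EuclideanSpace ℝ (Fin d) → ℝ}
    {G G' : EuclideanSpace ℝ (Fin d) → EuclideanSpace ℝ (Fin d)} (hG : HasWeakGradient u G)
    (hu : u =ᵐ[volume] u') (hGG : G =ᵐ[volume] G') : HasWeakGradient u' G' where
  locallyIntegrable := hG.locallyIntegrable.congr_ae hu
  locallyIntegrable_grad := hG.locallyIntegrable_grad.congr_ae hGG
  integral_eq φ hφ hs i := by
    have h1 : ∫ x, u' x * fderiv ℝ φ x (EuclideanSpace.single i 1) =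
        ∫ x, u x * fderiv ℝ φ x (EuclideanSpace.single i 1) :=
      integral_congr_ae (by filter_upwards [hu] with x hx; rw [hx])
    have h2 : ∫ x, φ x * G' x i = ∫ x, φ x * G x i :=
      integral_congr_ae (by filter_upwards [hGG] with x hx; rw [hx])
    rw [h1, h2, hG.integral_eq φ hφ hs i]

theorem gammaConst_nonneg {d : ℕ} (p : ℝ) (e : EuclideanSpace ℝ (Fin d)) : 0 ≤ gammaConst p e :=
  integral_nonneg fun _ => by positivity

section RadialIntegrals

variable {d : ℕ}

/-- The Taylor remainder `∫ |u(x + h) - u(x) - G(x) · h|^p / |h|^p ρ(|h|) dh`. -/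
noncomputable def nonlocalRemainder (ρ : ℝ → ℝ) (p : ℝ) (u : EuclideanSpace ℝ (Fin d) → ℝ)
    (G : EuclideanSpace ℝ (Fin d) → EuclideanSpace ℝ (Fin d))
    (x : EuclideanSpace ℝ (Fin d)) : ℝ≥0∞ :=
  ∫⁻ h, ENNReal.ofReal (|u (x + h) - u x - inner ℝ (G x) h| ^ p / ‖h‖ ^ p) ∂radialMeasure d ρ

variable {ρ : ℝ → ℝ} {p : ℝ} {u u' : EuclideanSpace ℝ (Fin d) → ℝ}
  {G G' : EuclideanSpace ℝ (Fin d) → EuclideanSpace ℝ (Fin d)}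

theorem ae_radialMeasure_comp_add_left (hu : u =ᵐ[volume] u') (x : EuclideanSpace ℝ (Fin d)) :
    ∀ᵐ h ∂radialMeasure d ρ, u (x + h) = u' (x + h) :=
  radialMeasure_absolutelyContinuous.ae_le
    ((measurePreserving_add_left volume x).quasiMeasurePreserving.ae_eq_comp hu)

theorem nonlocalRemainder_congr_ae (hu : u =ᵐ[volume] u') (hG : G =ᵐ[volume] G') :
    nonlocalRemainder ρ p u G =ᵐ[volume] nonlocalRemainder ρ p u' G' := by
  filter_upwards [hu, hG] with x hx hGx
  refine lintegral_congr_ae ?_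
  filter_upwards [ae_radialMeasure_comp_add_left hu x] with h hh
  rw [hx, hGx, hh]

theorem measurable_nonlocalRemainder (hu : Measurable u) (hG : Measurable G) :
    Measurable (nonlocalRemainder ρ p u G) :=
  Measurable.lintegral_prod_right' (f := fun z : EuclideanSpace ℝ (Fin d) ×
    EuclideanSpace ℝ (Fin d) => ENNReal.ofReal
      (|u (z.1 + z.2) - u z.1 - inner ℝ (G z.1) z.2| ^ p / ‖z.2‖ ^ p)) (by fun_prop)

theorem lintegral_nonlocalRemainder (hu : Measurable u) (hG : Measurable G) :
    ∫⁻ x, nonlocalRemainder ρ p u G x =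
      ∫⁻ h, (∫⁻ x, ENNReal.ofReal (|u (x + h) - u x - inner ℝ (G x) h| ^ p / ‖h‖ ^ p))
        ∂radialMeasure d ρ :=
  lintegral_lintegral_swap (by unfold Function.uncurry; fun_prop)

theorem MeasureTheory.MemLp.integrable_gammaConst_mul (hGp : MemLp G (ENNReal.ofReal p) volume)
    (hp : 1 ≤ p)
    (e : EuclideanSpace ℝ (Fin d)) : Integrable (fun x => gammaConst p e * ‖G x‖ ^ p) := by
  have := hGp.integrable_norm_rpow (by simpa using zero_lt_one.trans_le hp) ENNReal.ofReal_ne_top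
  rw [ENNReal.toReal_ofReal (by linarith)] at this
  exact this.const_mul _

theorem MeasureTheory.MemLp.lintegral_gammaConst_ne_top
    (hGp : MemLp G (ENNReal.ofReal p) volume) (hp : 1 ≤ p)
    (e : EuclideanSpace ℝ (Fin d)) :
    ∫⁻ x, ENNReal.ofReal (gammaConst p e * ‖G x‖ ^ p) ≠ ⊤ :=
  (hGp.integrable_gammaConst_mul hp e).lintegral_lt_top.ne

variable [NeZero d]

theorem lintegral_ofReal_mul_radial (hρ : IntegrableOn (fun r => ρ r * r ^ (d - 1)) (Set.Ioi 0))
    {a : EuclideanSpace ℝ (Fin d) → ℝ} (ha : ∀ h, 0 ≤ a h) :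
    ∫⁻ h, ENNReal.ofReal (a h * ρ ‖h‖) = ∫⁻ h, ENNReal.ofReal (a h) ∂radialMeasure d ρ := by
  rw [lintegral_radialMeasure hρ]
  refine lintegral_congr fun h => ?_
  rw [ENNReal.ofReal_mul (ha h), mul_comm]

theorem nonlocalD_eq_lintegral_radialMeasure
    (hρ : IntegrableOn (fun r => ρ r * r ^ (d - 1)) (Set.Ioi 0))
    (u : EuclideanSpace ℝ (Fin d) → ℝ) (x : EuclideanSpace ℝ (Fin d)) :
    nonlocalD ρ p u x =
      ∫⁻ h, ENNReal.ofReal (|u (x + h) - u x| ^ p / ‖h‖ ^ p) ∂radialMeasure d ρ := by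
  rw [nonlocalD, ← lintegral_add_left_eq_self _ x, ← lintegral_ofReal_mul_radial hρ
    fun h => by positivity]
  simp [abs_sub_comm]

theorem nonlocalD_congr_ae (hρ : IntegrableOn (fun r => ρ r * r ^ (d - 1)) (Set.Ioi 0))
    (hu : u =ᵐ[volume] u') : nonlocalD ρ p u =ᵐ[volume] nonlocalD ρ p u' := by
  filter_upwards [hu] with x hx
  rw [nonlocalD_eq_lintegral_radialMeasure hρ, nonlocalD_eq_lintegral_radialMeasure hρ]
  refine lintegral_congr_ae ?_
  filter_upwards [ae_radialMeasure_comp_add_left hu x] with h hh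
  rw [hx, hh]

theorem measurable_nonlocalD (hρ : IntegrableOn (fun r => ρ r * r ^ (d - 1)) (Set.Ioi 0))
    (hu : Measurable u) : Measurable (nonlocalD ρ p u) := by
  simp_rw [funext fun x => nonlocalD_eq_lintegral_radialMeasure (p := p) hρ u x]
  exact Measurable.lintegral_prod_right' (f := fun z : EuclideanSpace ℝ (Fin d) ×
    EuclideanSpace ℝ (Fin d) => ENNReal.ofReal (|u (z.1 + z.2) - u z.1| ^ p / ‖z.2‖ ^ p))
    (by fun_prop)

end RadialIntegrals

/-! ### Passage to the limit. -/

namespace IsRadialMollifier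

variable {d : ℕ} [NeZero d] {ρ : ℕ → ℝ → ℝ} {p : ℝ} {u : EuclideanSpace ℝ (Fin d) → ℝ}
  {G : EuclideanSpace ℝ (Fin d) → EuclideanSpace ℝ (Fin d)}

theorem lintegral_nonlocalRemainder_ne_top (hρ : IsRadialMollifier d ρ) (hp : 1 ≤ p)
    (hG : HasWeakGradient u G) (hu : Measurable u) (hGm : Measurable G)
    (hGp : MemLp G (ENNReal.ofReal p) volume) (n : ℕ) :
    ∫⁻ x, nonlocalRemainder (ρ n) p u G x ≠ ⊤ := by
  rw [lintegral_nonlocalRemainder hu hGm]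
  refine ne_top_of_le_ne_top ?_ (lintegral_mono fun h => hG.lintegral_remainder_le_const hGm hp h)
  rw [lintegral_const, hρ.radialMeasure_univ n]
  exact ENNReal.mul_ne_top (ENNReal.rpow_ne_top_of_nonneg (by linarith)
    (ENNReal.mul_ne_top (by simp) hGp.eLpNorm_ne_top)) (measure_ne_top _ _)

theorem tendsto_lintegral_nonlocalRemainder (hρ : IsRadialMollifier d ρ) (hp : 1 ≤ p)
    (hG : HasWeakGradient u G) (hu : Measurable u) (hGm : Measurable G)
    (hGp : MemLp G (ENNReal.ofReal p) volume) :
    Tendsto (fun n => ∫⁻ x, nonlocalRemainder (ρ n) p u G x) atTop (𝓝 0) := by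
  simp_rw [lintegral_nonlocalRemainder hu hGm]
  exact tendsto_lintegral_of_concentrating (measure_ne_top _ _)
    (fun n => (hρ.radialMeasure_univ n).le) (fun δ hδ => hρ.radialMeasure_tail hδ)
    (ENNReal.rpow_ne_top_of_nonneg (by linarith) (ENNReal.mul_ne_top (by simp) hGp.eLpNorm_ne_top))
    (fun h => hG.lintegral_remainder_le_const hGm hp h)
    (hG.tendsto_lintegral_remainder hGm hp hGp)

/-- The elementary inequality integrated in h. The point is that K depends only on p and ε, so ε can
be fixed before n grows. -/
theorem exists_nonlocalD_compare (hρ : IsRadialMollifier d ρ) (hp : 0 < p) (hu : Measurable u)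
    {ε : ℝ} (hε : 0 < ε) : ∃ K : ℝ≥0∞, K ≠ ⊤ ∧
      ∀ (n : ℕ) (e : EuclideanSpace ℝ (Fin d)), ‖e‖ = 1 → ∀ x,
      nonlocalD (ρ n) p u x ≤ ENNReal.ofReal (gammaConst p e * ‖G x‖ ^ p) +
        (ENNReal.ofReal ε * ENNReal.ofReal (gammaConst p e * ‖G x‖ ^ p) +
          K * nonlocalRemainder (ρ n) p u G x) ∧
      ENNReal.ofReal (gammaConst p e * ‖G x‖ ^ p) ≤ nonlocalD (ρ n) p u x +
        (ENNReal.ofReal ε * ENNReal.ofReal (gammaConst p e * ‖G x‖ ^ p) +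
          K * nonlocalRemainder (ρ n) p u G x) := by
  obtain ⟨K, hK, hab⟩ := exists_abs_rpow_sub_le hp hε
  refine ⟨ENNReal.ofReal K, ENNReal.ofReal_ne_top, fun n e he x => ?_⟩
  have hscale : ∀ a b c h' : ℝ, 0 ≤ a → 0 ≤ b → 0 ≤ c → 0 ≤ h' → ∀ a', a' ≤ a + (ε * b + K * c) →
      ENNReal.ofReal (a' / h') ≤ ENNReal.ofReal (a / h') +
        (ENNReal.ofReal ε * ENNReal.ofReal (b / h') + ENNReal.ofReal K * ENNReal.ofReal (c / h')) := by
    intro a b c h' ha hb hc hh a' ha'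
    rw [← ENNReal.ofReal_mul hε.le, ← ENNReal.ofReal_mul hK,
      ← ENNReal.ofReal_add (by positivity) (by positivity),
      ← ENNReal.ofReal_add (by positivity) (by positivity)]
    refine ENNReal.ofReal_le_ofReal ((div_le_div_of_nonneg_right ha' hh).trans_eq ?_)
    ring
  rw [nonlocalD_eq_lintegral_radialMeasure (hρ.integrableOn n), ← hρ.lintegral_inner n hp he,
    nonlocalRemainder, ← lintegral_const_mul _ (by fun_prop), ← lintegral_const_mul _ (by fun_prop),
    ← lintegral_add_left (by fun_prop), ← lintegral_add_left (by fun_prop),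
    ← lintegral_add_left (by fun_prop)]
  exact ⟨lintegral_mono fun h => hscale _ _ _ _ (by positivity) (by positivity) (by positivity)
      (by positivity) _ (hab _ _).1,
    lintegral_mono fun h => hscale _ _ _ _ (by positivity) (by positivity) (by positivity)
      (by positivity) _ (hab _ _).2⟩

theorem lintegral_nonlocalD_ne_top (hρ : IsRadialMollifier d ρ) (hp : 1 ≤ p)
    (hG : HasWeakGradient u G) (hu : Measurable u) (hGm : Measurable G)
    (hGp : MemLp G (ENNReal.ofReal p) volume) (n : ℕ) :
    ∫⁻ x, nonlocalD (ρ n) p u x ≠ ⊤ := by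
  -- For finiteness any unit vector and ε = 1 suffice.
  obtain ⟨e, he⟩ := exists_norm_eq (EuclideanSpace ℝ (Fin d)) zero_le_one
  obtain ⟨K, hK, hc⟩ := hρ.exists_nonlocalD_compare (G := G) (zero_lt_one.trans_le hp) hu one_pos
  refine ne_top_of_le_ne_top ?_ (lintegral_mono fun x => (hc n e he x).1)
  have hB := hGp.lintegral_gammaConst_ne_top hp e
  rw [lintegral_add_left (by fun_prop), lintegral_add_left (by fun_prop),
    lintegral_const_mul _ (by fun_prop),
    lintegral_const_mul _ (measurable_nonlocalRemainder hu hGm)]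
  exact ENNReal.add_ne_top.2 ⟨hB, ENNReal.add_ne_top.2 ⟨ENNReal.mul_ne_top (by simp) hB,
    ENNReal.mul_ne_top hK (hρ.lintegral_nonlocalRemainder_ne_top hp hG hu hGm hGp n)⟩⟩

theorem tendsto_eLpNorm_nonlocalD_sub (hρ : IsRadialMollifier d ρ) (hp : 1 ≤ p)
    (hG : HasWeakGradient u G) (hu : Measurable u) (hGm : Measurable G)
    (hGp : MemLp G (ENNReal.ofReal p) volume) {e : EuclideanSpace ℝ (Fin d)} (he : ‖e‖ = 1) :
    Tendsto (fun n => eLpNorm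
      (fun x => (nonlocalD (ρ n) p u x).toReal - gammaConst p e * ‖G x‖ ^ p) 1 volume)
      atTop (𝓝 0) := by
  set B := ∫⁻ x, ENNReal.ofReal (gammaConst p e * ‖G x‖ ^ p)
  have hB : B ≠ ⊤ := hGp.lintegral_gammaConst_ne_top hp e
  rw [ENNReal.tendsto_nhds_zero]
  intro η hη
  have hη2 : 0 < η / 2 := ENNReal.half_pos hη.ne'
  have hlim : Tendsto (fun ε : ℝ => ENNReal.ofReal ε * B) (𝓝[>] 0) (𝓝 0) := by
    have := ENNReal.Tendsto.mul_const (b := B)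
      (ENNReal.tendsto_ofReal (tendsto_id (α := ℝ) (x := 𝓝 0))) (Or.inr hB)
    simp only [ENNReal.ofReal_zero, zero_mul] at this
    exact this.mono_left nhdsWithin_le_nhds
  obtain ⟨ε, hεB, hε⟩ :=
    ((hlim.eventually_le_const hη2).and eventually_mem_nhdsWithin).exists
  obtain ⟨K, hK, hc⟩ := hρ.exists_nonlocalD_compare (G := G) (zero_lt_one.trans_le hp) hu hε
  have hR := ENNReal.Tendsto.const_mul (a := K)
    (hρ.tendsto_lintegral_nonlocalRemainder hp hG hu hGm hGp) (Or.inr hK)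
  rw [mul_zero] at hR
  filter_upwards [hR.eventually_le_const hη2] with n hn
  rw [eLpNorm_one_eq_lintegral_enorm]
  calc
    _ ≤ ∫⁻ x, (ENNReal.ofReal ε * ENNReal.ofReal (gammaConst p e * ‖G x‖ ^ p) +
          K * nonlocalRemainder (ρ n) p u G x) := by
        refine lintegral_mono fun x => ?_
        have h := ENNReal.enorm_toReal_sub_toReal_le ENNReal.ofReal_ne_top (hc n e he x).1
          (hc n e he x).2
        rwa [ENNReal.toReal_ofReal (mul_nonneg (gammaConst_nonneg p e) (by positivity))] at h
    _ = ENNReal.ofReal ε * B + K * ∫⁻ x, nonlocalRemainder (ρ n) p u G x := by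
        rw [lintegral_add_left (by fun_prop), lintegral_const_mul _ (by fun_prop),
          lintegral_const_mul _ (measurable_nonlocalRemainder hu hGm)]
    _ ≤ η / 2 + η / 2 := add_le_add hεB hn
    _ = η := ENNReal.add_halves η

end IsRadialMollifier

theorem mainTheorem2 (d : ℕ) (hd : 1 ≤ d) (ρ : ℕ → ℝ → ℝ) (hρ : IsRadialMollifier d ρ)
    (p : ℝ) (hp : 1 ≤ p) (u : EuclideanSpace ℝ (Fin d) → ℝ) (hu : LocallyIntegrable u volume)
    (G : EuclideanSpace ℝ (Fin d) → EuclideanSpace ℝ (Fin d)) (hG : HasWeakGradient u G)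
    (hGp : MemLp G (ENNReal.ofReal p) volume) :
    Tendsto (fun n => ∫⁻ x : EuclideanSpace ℝ (Fin d), ∫⁻ h : EuclideanSpace ℝ (Fin d),
        ENNReal.ofReal (|u (x + h) - u x - inner ℝ (G x) h| ^ p / ‖h‖ ^ p * ρ n ‖h‖))
      atTop (𝓝 0) ∧
    (∀ n, (∀ᵐ x, nonlocalD (ρ n) p u x < ⊤) ∧
      Integrable (fun x => (nonlocalD (ρ n) p u x).toReal) volume) ∧
    ∀ e : EuclideanSpace ℝ (Fin d), ‖e‖ = 1 →
      Integrable (fun x => gammaConst p e * ‖G x‖ ^ p) volume ∧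
      Tendsto (fun n => eLpNorm
          (fun x => (nonlocalD (ρ n) p u x).toReal - gammaConst p e * ‖G x‖ ^ p) 1 volume)
        atTop (𝓝 0) := by
  have : NeZero d := ⟨by omega⟩
  -- Tonelli is applied to Borel representatives; since ν_n ≪ dx, the nonlocal quantities change
  -- only on a null set of x.
  obtain ⟨u', hu'm, huu⟩ := hu.aestronglyMeasurable.aemeasurable
  obtain ⟨G', hG'm, hGG⟩ := hGp.aestronglyMeasurable.aemeasurable
  have hG' := hG.congr_ae huu hGG
  have hGp' := hGp.ae_eq hGG
  have hD := fun n => nonlocalD_congr_ae (p := p) (hρ.integrableOn n) huu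
  refine ⟨?_, fun n => ?_, fun e he => ⟨hGp.integrable_gammaConst_mul hp e, ?_⟩⟩
  · refine (hρ.tendsto_lintegral_nonlocalRemainder hp hG' hu'm hG'm hGp').congr fun n => ?_
    rw [← lintegral_congr_ae (nonlocalRemainder_congr_ae huu hGG)]
    refine lintegral_congr fun x => ?_
    rw [lintegral_ofReal_mul_radial (hρ.integrableOn n) fun h => by positivity]
    rfl
  · have hfin := hρ.lintegral_nonlocalD_ne_top hp hG' hu'm hG'm hGp' n
    have hm := measurable_nonlocalD (p := p) (hρ.integrableOn n) hu'm
    constructor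
    · filter_upwards [hD n, ae_lt_top hm hfin] with x hx hlt
      rwa [hx]
    · refine (integrable_toReal_of_lintegral_ne_top hm.aemeasurable hfin).congr ?_
      filter_upwards [hD n] with x hx
      rw [hx]
  · refine (hρ.tendsto_eLpNorm_nonlocalD_sub hp hG' hu'm hG'm hGp' he).congr fun n =>
      eLpNorm_congr_ae ?_
    filter_upwards [hD n, hGG] with x hx hGx
    rw [hx, hGx]
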